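/- Let $\Omega=\{0,1\}^{\infty}$ with the product topology. For $\omega\in\Omega$ and $t\ge 0$ let $\omega^t\subseteq\Omega$ be the cylinder of all paths that agree with $\omega$ in the first $t$ periods, and let $\Sigma$ be any $\sigma$-algebra on $\Omega$ (its members are the events) that contains all cylinders. Let $\mathbb P$ be the set of finitely additive probabilities on $(\Omega,\Sigma)$. An opinion is a $P\in\mathbb P$ that is strongly nonatomic: for every event $E$ and every $\alpha\in[0,1]$ there is an event $F\subseteq E$ with $P(F)=\alpha P(E)$. Let $\Delta$ be the set of opinions. For $P,Q\in\mathbb P$ write $Q\ll P$ if, for every sequence of events $(E_n)$, $P(E_n)\to 0$ implies $Q(E_n)\to 0$. Say that $P$ merges with $Q$ if for every $\varepsilon>0$ \[\lim_{t\to\infty}Q\Bigl(\Bigl\{\omega:\sup_{E\in\Sigma}\bigl|P(E\mid\omega^t)-Q(E\mid\omega^t)\bigr|>\varepsilon\Bigr\}\Bigr)=0 ,\] where $P(E\mid C)=P(E\cap C)/P(C)$, read as $0$ if $P(C)=0$. Let $\Delta_{\mathrm{BD}}$ be the set of opinions $P$ that merge with every $Q\in\mathbb P$ such that $Q\ll P$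 (the opinions with the Blackwell--Dubins property). A test is a function $T$ from $\Delta$ to the open subsets of $\Omega$; opinion $P$ is rejected on $T(P)$. For $\varepsilon\in[0,1)$, $T$ $\Delta_{\mathrm{BD}}$-controls for type I error with probability $1-\varepsilon$ if $P(T(P))\le\varepsilon$ for every $P\in\Delta_{\mathrm{BD}}$. A strategy is a probability measure on $\Delta$ with finite support. A strictly proper ideal is a collection $\mathcal I$ of subsets of $\Omega$ that is closed under taking subsets and under unions of two members and contains no cylinder; its members are called small. Let $\mathcal I$ be a strictly proper ideal, and let $T$ be a test that $\Delta_{\mathrm{BD}}$-controls for type I error with probability $1-\varepsilon$ for some $\varepsilon\in[0,1)$. Then there exists a strategy $\zeta$ such that the set \[\bigl\{\omega\in\Omega:\ \zeta(\{P\in\Delta:\ \omega\notin T(P)\})=1\bigr\}\] is not small, that is, does not belong to $\mathcal I$. -/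

import Mathlib

open Set Filter Topology
open scoped MeasureTheory

namespace OpinionTest

/-- A path is an infinite sequence of binary outcomes. The space of paths carries the product
topology (the discrete topology on each factor). The cylinder `ω^t` of all paths that agree
with `ω` in the first `t` periods is `PiNat.cylinder ω t`. -/
abbrev Path : Type := ℕ → Bool

/-- A finitely additive probability on `(Path, 𝓢)`, where `𝓢` is the `σ`-algebra of events.
The value at a set that is not an event is fixed to be `0`, so that two probabilities are equal
exactly when they agree on all events. -/
@[ext]
structure FinAddProb (𝓢 : MeasurableSpace Path) where
  toFun : Set Path → ℝ
  zero_of_not_event : ∀ E, ¬ MeasurableSet[𝓢] E → toFun E = 0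
  nonneg : ∀ E, MeasurableSet[𝓢] E → 0 ≤ toFun E
  prob_univ : toFun Set.univ = 1
  prob_union : ∀ E F, MeasurableSet[𝓢] E → MeasurableSet[𝓢] F → Disjoint E F →
    toFun (E ∪ F) = toFun E + toFun F

instance (𝓢 : MeasurableSpace Path) : CoeFun (FinAddProb 𝓢) (fun _ => Set Path → ℝ) :=
  ⟨FinAddProb.toFun⟩

variable {𝓢 : MeasurableSpace Path}

/-- `P` is strongly nonatomic (Savagean). -/
def IsSavagean (P : FinAddProb 𝓢) : Prop :=
  ∀ E, MeasurableSet[𝓢] E → ∀ α : ℝ, 0 ≤ α → α ≤ 1 →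
    ∃ F, F ⊆ E ∧ MeasurableSet[𝓢] F ∧ P F = α * P E

/-- The set `Δ` of opinions: the strongly nonatomic finitely additive probabilities. -/
def Opinion (𝓢 : MeasurableSpace Path) : Type := {P : FinAddProb 𝓢 // IsSavagean P}

/-- The conditional probability `P(E | C) = P(E ∩ C) / P(C)`, with value `0` if `P(C) = 0`. -/
noncomputable def condProb (P : FinAddProb 𝓢) (E C : Set Path) : ℝ := P (E ∩ C) / P C

/-- The distance `sup_{E ∈ 𝓢} |P(E | ω^t) - Q(E | ω^t)|` between the forecasts of `P` and `Q`. -/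
noncomputable def forecastDist (P Q : FinAddProb 𝓢) (ω : Path) (t : ℕ) : ℝ :=
  ⨆ E : {E : Set Path // MeasurableSet[𝓢] E},
    |condProb P E.1 (PiNat.cylinder ω t) - condProb Q E.1 (PiNat.cylinder ω t)|

/-- `P` merges with `Q`: the distance between forecasts goes to `0` in `Q`-probability. For each
`t` the set of paths below is a finite union of cylinders of length `t`, hence an event as soon
as cylinders are events. -/
def Merges (P Q : FinAddProb 𝓢) : Prop :=
  ∀ ε : ℝ, 0 < ε → Tendsto (fun t : ℕ => Q {ω | ε < forecastDist P Q ω t}) atTop (𝓝 0)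

/-- `Q ≪ P`: along every sequence of events, `P (E n) → 0` implies `Q (E n) → 0`. -/
def AbsCont (Q P : FinAddProb 𝓢) : Prop :=
  ∀ E : ℕ → Set Path, (∀ n, MeasurableSet[𝓢] (E n)) →
    Tendsto (fun n => P (E n)) atTop (𝓝 0) → Tendsto (fun n => Q (E n)) atTop (𝓝 0)

/-- The Blackwell--Dubins property: `P` merges with every finitely additive probability that is
absolutely continuous with respect to `P`. -/
def BlackwellDubins (P : FinAddProb 𝓢) : Prop :=
  ∀ Q : FinAddProb 𝓢, AbsCont Q P → Merges P Q

/-- The set `Δ_BD` of opinions with the Blackwell--Dubins property. -/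
def opinionsBD (𝓢 : MeasurableSpace Path) : Set (Opinion 𝓢) := {P | BlackwellDubins P.1}

/-- A test assigns to every opinion the open set of paths on which the opinion is rejected. -/
def Test (𝓢 : MeasurableSpace Path) : Type := Opinion 𝓢 → TopologicalSpace.Opens Path

/-- The test `T` `Λ`-controls for type I error with probability `1 - ε`. -/
def ControlsTypeIError (T : Test 𝓢) (Λ : Set (Opinion 𝓢)) (ε : ℝ) : Prop :=
  ∀ P ∈ Λ, P.1 (T P : Set Path) ≤ ε

/-- A strategy is a probability measure on the set of opinions with finite support. -/
def Strategy (𝓢 : MeasurableSpace Path) : Type :=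
  {ζ : PMF (Opinion 𝓢) // ζ.support.Finite}

/-- The probability `ζ(A)` that a strategy gives to a set `A` of opinions. -/
noncomputable def Strategy.prob (ζ : Strategy 𝓢) (A : Set (Opinion 𝓢)) : ENNReal :=
  ζ.1.toOuterMeasure A

/-- A strictly proper ideal of sets of paths; its members are the small sets. -/
structure IsStrictlyProperIdeal (I : Set (Set Path)) : Prop where
  mem_of_subset : ∀ S R : Set Path, S ∈ I → R ⊆ S → R ∈ I
  union_mem : ∀ R S : Set Path, R ∈ I → S ∈ I → R ∪ S ∈ I
  cylinder_notMem : ∀ (ω : Path) (t : ℕ), PiNat.cylinder ω t ∉ I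

end OpinionTest

/-!
One opinion does the job: an opinion `P` with the Blackwell-Dubins property that vanishes on all
small sets. If the set of paths on which `P` is not rejected were small, then `P` would give the
rejection set probability `1 > ε`.

To construct `P`, fix an atomless probability measure `μ` and let `p S` be the `μ`-measure of the
closed set of points near which `S` is not small. This `p` is submodular, vanishes on small sets,
and `p F ≤ μ F` for closed `F`; moreover every set is covered, up to a set of small capacity, by
a clopen set of nearly the same capacity. All this survives in a minimal capacity below `p`, and a
minimal one is additive because it equals its contractions. The bound by `μ` makes it strongly
nonatomic, and the clopen sets are dense for it, so a charge `Q ≪ P` is uniformly close to one with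
a step density that depends on finitely many periods. Conditionally on a longer history that
density is constant, hence the forecasts of `P` and `Q` are close except on a set of small
`Q`-probability.
-/

namespace OpinionTest

open MeasureTheory
open PiNat (cylinder self_mem_cylinder mem_cylinder_iff_eq cylinder_anti)
open scoped symmDiff

section Charge

variable {α ι κ : Type*} {m : MeasurableSpace α} {ν P R : Set α → ℝ}

/-- A charge: a real-valued set function that is finitely additive on the measurable sets. Its
values on other sets are not constrained. -/
def IsCharge (m : MeasurableSpace α) (ν : Set α → ℝ) : Prop :=
  ∀ ⦃E F : Set α⦄, MeasurableSet[m] E → MeasurableSet[m] F → Disjoint E F →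
    ν (E ∪ F) = ν E + ν F

/-- The family `𝒞` is dense among the measurable sets for the pseudometric `R (E ∆ F)`. -/
def ChargeDense (m : MeasurableSpace α) (R : Set α → ℝ) (𝒞 : Set (Set α)) : Prop :=
  ∀ E, MeasurableSet[m] E → ∀ δ > 0, ∃ C ∈ 𝒞, R (E ∆ C) < δ

theorem pairwiseDisjoint_inter_fiber (E : Set α) (f : α → κ) (s : Set κ) :
    s.PairwiseDisjoint fun k => E ∩ f ⁻¹' {k} := fun _ _ _ _ hkl =>
  ((disjoint_singleton.2 hkl).preimage f).mono inter_subset_right inter_subset_right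

theorem measurableSet_preimage_of_fiber [Countable κ] {f : α → κ}
    (hf : ∀ k, MeasurableSet (f ⁻¹' {k})) (s : Set κ) : MeasurableSet (f ⁻¹' s) := by
  rw [← biUnion_preimage_singleton]
  exact .biUnion (to_countable s) fun k _ => hf k

namespace IsCharge

theorem empty (hν : IsCharge m ν) : ν ∅ = 0 := by
  simpa using hν MeasurableSet.empty MeasurableSet.empty disjoint_bot_left

theorem add (hP : IsCharge m P) (hR : IsCharge m R) : IsCharge m (fun E => P E + R E) :=
  fun E F hE hF hEF => by
    simp only [hP hE hF hEF, hR hE hF hEF]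
    ring

theorem sub (hP : IsCharge m P) (hR : IsCharge m R) : IsCharge m (fun E => P E - R E) :=
  fun E F hE hF hEF => by
    simp only [hP hE hF hEF, hR hE hF hEF]
    ring

theorem inter_add_sdiff (hν : IsCharge m ν) {E F : Set α} (hE : MeasurableSet E)
    (hF : MeasurableSet F) : ν (E ∩ F) + ν (E \ F) = ν E := by
  rw [← hν (hE.inter hF) (hE.diff hF) disjoint_inf_sdiff, inter_union_sdiff]

theorem mono (hν : IsCharge m ν) (hν₀ : ∀ E, MeasurableSet E → 0 ≤ ν E) {E F : Set α}
    (hE : MeasurableSet E) (hF : MeasurableSet F) (hEF : E ⊆ F) : ν E ≤ ν F := by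
  have h := hν.inter_add_sdiff hF hE
  rw [inter_eq_right.2 hEF] at h
  linarith [hν₀ _ (hF.diff hE)]

theorem apply_biUnion (hν : IsCharge m ν) (s : Finset ι) {F : ι → Set α}
    (hF : ∀ i ∈ s, MeasurableSet (F i)) (hd : (s : Set ι).PairwiseDisjoint F) :
    ν (⋃ i ∈ s, F i) = ∑ i ∈ s, ν (F i) := by
  classical
  induction s using Finset.induction_on with
  | empty => simpa using hν.empty
  | insert a s ha ih =>
    rw [Finset.coe_insert, pairwiseDisjoint_insert_of_notMem (by simpa using ha)] at hd
    rw [Finset.forall_mem_insert] at hF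
    rw [Finset.sum_insert ha, Finset.set_biUnion_insert, ← ih hF.2 hd.1]
    exact hν hF.1 (s.measurableSet_biUnion hF.2) (disjoint_iUnion₂_right.2 hd.2)

theorem sum_inter_fiber [Fintype κ] (hν : IsCharge m ν) {f : α → κ}
    (hf : ∀ k, MeasurableSet (f ⁻¹' {k})) {E : Set α} (hE : MeasurableSet E) :
    ∑ k, ν (E ∩ f ⁻¹' {k}) = ν E := by
  rw [← hν.apply_biUnion _ (fun k _ => hE.inter (hf k)) (pairwiseDisjoint_inter_fiber E f _)]
  congr 1
  ext x
  simp

theorem sum_abs_le (hν : IsCharge m ν) {η : ℝ} (hη : ∀ E, MeasurableSet E → |ν E| ≤ η)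
    (s : Finset ι) {F : ι → Set α} (hF : ∀ i ∈ s, MeasurableSet (F i))
    (hd : (s : Set ι).PairwiseDisjoint F) : ∑ i ∈ s, |ν (F i)| ≤ 2 * η := by
  have hsub (q : ι → Prop) [DecidablePred q] : |∑ i ∈ s with q i, ν (F i)| ≤ η := by
    have hF' : ∀ i ∈ s.filter q, MeasurableSet (F i) :=
      fun i hi => hF i (Finset.mem_of_mem_filter i hi)
    rw [← hν.apply_biUnion _ hF' (hd.subset (Finset.coe_subset.2 (s.filter_subset q)))]
    exact hη _ (Finset.measurableSet_biUnion _ hF')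
  have hpos : ∑ i ∈ s with 0 ≤ ν (F i), |ν (F i)| = ∑ i ∈ s with 0 ≤ ν (F i), ν (F i) :=
    Finset.sum_congr rfl fun i hi => abs_of_nonneg (Finset.mem_filter.1 hi).2
  have hneg : ∑ i ∈ s with ¬ 0 ≤ ν (F i), |ν (F i)| = -∑ i ∈ s with ¬ 0 ≤ ν (F i), ν (F i) := by
    rw [← Finset.sum_neg_distrib]
    exact Finset.sum_congr rfl fun i hi =>
      abs_of_neg (not_le.1 (Finset.mem_filter.1 hi).2)
  rw [← Finset.sum_filter_add_sum_filter_not s (fun i => 0 ≤ ν (F i)), hpos, hneg]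
  linarith [le_of_abs_le (hsub fun i => 0 ≤ ν (F i)),
    neg_le_of_abs_le (hsub fun i => ¬ 0 ≤ ν (F i))]

theorem abs_sub_le_mul_symmDiff (hν : IsCharge m ν) (hR : IsCharge m R) {M : ℝ}
    (hM : ∀ F, MeasurableSet F → |ν F| ≤ M * R F) {E C : Set α} (hE : MeasurableSet E)
    (hC : MeasurableSet C) : |ν E - ν C| ≤ M * R (E ∆ C) := by
  have hE' := hν.inter_add_sdiff hE hC
  have hC' := hν.inter_add_sdiff hC hE
  rw [inter_comm] at hC'
  calc |ν E - ν C| = |ν (E \ C) - ν (C \ E)| := by rw [← hE', ← hC']; congr 1; ring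
    _ ≤ |ν (E \ C)| + |ν (C \ E)| := abs_sub _ _
    _ ≤ M * R (E \ C) + M * R (C \ E) := add_le_add (hM _ (hE.diff hC)) (hM _ (hC.diff hE))
    _ = M * R (E ∆ C) := by
      rw [Set.symmDiff_def, hR (hE.diff hC) (hC.diff hE) disjoint_sdiff_sdiff, mul_add]

theorem abs_le_of_chargeDense (hν : IsCharge m ν) (hR : IsCharge m R) {𝒞 : Set (Set α)}
    (h𝒞 : ∀ C ∈ 𝒞, MeasurableSet C) (hdense : ChargeDense m R 𝒞) {M η : ℝ} (hM₀ : 0 ≤ M)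
    (hM : ∀ F, MeasurableSet F → |ν F| ≤ M * R F) (hη : ∀ C ∈ 𝒞, |ν C| ≤ η) {E : Set α}
    (hE : MeasurableSet E) : |ν E| ≤ η := by
  refine le_of_forall_pos_le_add fun δ hδ => ?_
  obtain ⟨C, hC, hEC⟩ := hdense E hE (δ / (M + 1)) (by positivity)
  have hsmall : M * R (E ∆ C) ≤ δ := by
    calc M * R (E ∆ C) ≤ M * (δ / (M + 1)) := by gcongr
      _ ≤ (M + 1) * (δ / (M + 1)) := by gcongr; linarith
      _ = δ := by field_simp
  linarith [abs_sub_abs_le_abs_sub (ν E) (ν C), hη C hC,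
    hν.abs_sub_le_mul_symmDiff hR hM hE (h𝒞 C hC)]

theorem continuous_apply_inter_preimage_Iic (hν : IsCharge m ν)
    (hν₀ : ∀ E, MeasurableSet E → 0 ≤ ν E) {X : α → ℝ} (hXm : ∀ c, MeasurableSet (X ⁻¹' Iic c))
    {G : ℝ → ℝ} (hG : Continuous G) (hνG : ∀ c d, c ≤ d → ν (X ⁻¹' Ioc c d) ≤ G d - G c)
    {E : Set α} (hE : MeasurableSet E) : Continuous fun c => ν (E ∩ X ⁻¹' Iic c) := by
  set h : ℝ → ℝ := fun c => ν (E ∩ X ⁻¹' Iic c)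
  have hle {c d : ℝ} (hcd : c ≤ d) : dist (h d) (h c) ≤ dist (G d) (G c) := by
    have hsplit := hν.inter_add_sdiff (hE.inter (hXm d)) (hXm c)
    rw [inter_assoc, ← preimage_inter, Iic_inter_Iic, min_eq_right hcd, inter_sdiff_assoc,
      ← preimage_sdiff, Iic_sdiff_Iic] at hsplit
    have hIoc : MeasurableSet (X ⁻¹' Ioc c d) := by
      rw [← Iic_sdiff_Iic, preimage_sdiff]
      exact (hXm d).diff (hXm c)
    rw [Real.dist_eq, Real.dist_eq]
    refine (abs_of_nonneg ?_).trans_le ((?_ : _ ≤ G d - G c).trans (le_abs_self _))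
    · linarith [hν₀ _ (hE.inter hIoc)]
    · linarith [hν.mono hν₀ (hE.inter hIoc) hIoc inter_subset_right, hνG c d hcd]
  refine continuous_iff_continuousAt.2 fun c => tendsto_iff_dist_tendsto_zero.2
    (squeeze_zero (fun _ => dist_nonneg) (fun d => ?_)
      (tendsto_iff_dist_tendsto_zero.1 (hG.tendsto c)))
  rcases le_total c d with hcd | hcd
  · exact hle hcd
  · rw [dist_comm, dist_comm (G d)]
    exact hle hcd

theorem exists_subset_apply_eq (hν : IsCharge m ν) (hν₀ : ∀ E, MeasurableSet E → 0 ≤ ν E)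
    {X : α → ℝ} {a b : ℝ} (hX : ∀ x, X x ∈ Icc a b) (hXm : ∀ c, MeasurableSet (X ⁻¹' Iic c))
    {G : ℝ → ℝ} (hG : Continuous G) (hνG : ∀ c d, c ≤ d → ν (X ⁻¹' Ioc c d) ≤ G d - G c)
    {E : Set α} (hE : MeasurableSet E) {r : ℝ} (hr : r ∈ Icc 0 (ν E)) :
    ∃ F ⊆ E, MeasurableSet F ∧ ν F = r := by
  have hlow : ν (E ∩ X ⁻¹' Iic (a - 1)) = 0 := by
    have : X ⁻¹' Iic (a - 1) = ∅ :=
      eq_empty_of_forall_notMem fun x (hx : X x ≤ a - 1) => by linarith [(hX x).1]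
    rw [this, inter_empty, hν.empty]
  have hhigh : ν (E ∩ X ⁻¹' Iic b) = ν E := by
    have : X ⁻¹' Iic b = univ := eq_univ_of_forall fun x => (hX x).2
    rw [this, inter_univ]
  obtain ⟨c, hc⟩ := mem_range_of_exists_le_of_exists_ge
    (hν.continuous_apply_inter_preimage_Iic hν₀ hXm hG hνG hE) ⟨a - 1, hlow.trans_le hr.1⟩
    ⟨b, hr.2.trans_eq hhigh.symm⟩
  exact ⟨_, inter_subset_left, hE.inter (hXm c), hc⟩

end IsCharge

section StepDensity

variable [Fintype κ] {f : α → κ}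

/-- The set function with density `X ∘ f` with respect to `ν`, for a map `f` with finitely many
values. -/
def withStepDensity (ν : Set α → ℝ) (f : α → κ) (X : κ → ℝ) (E : Set α) : ℝ :=
  ∑ k, X k * ν (E ∩ f ⁻¹' {k})

theorem IsCharge.withStepDensity (hν : IsCharge m ν) (hf : ∀ k, MeasurableSet (f ⁻¹' {k}))
    (X : κ → ℝ) : IsCharge m (withStepDensity ν f X) := fun E F hE hF hEF => by
  simp only [OpinionTest.withStepDensity, union_inter_distrib_right, ← Finset.sum_add_distrib,
    ← mul_add]
  exact Finset.sum_congr rfl fun k _ => by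
    rw [hν (hE.inter (hf k)) (hF.inter (hf k)) (hEF.mono inter_subset_left inter_subset_left)]

theorem withStepDensity_of_subset_fiber (hν : ν ∅ = 0) (X : κ → ℝ) {k : κ} {E : Set α}
    (hE : E ⊆ f ⁻¹' {k}) : withStepDensity ν f X E = X k * ν E := by
  rw [withStepDensity, Finset.sum_eq_single_of_mem k (Finset.mem_univ k), inter_eq_left.2 hE]
  intro l _ hl
  have hdisj : Disjoint E (f ⁻¹' {l}) :=
    ((disjoint_singleton.2 hl.symm).preimage f).mono_left hE
  rw [hdisj.inter_eq, hν, mul_zero]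

theorem abs_withStepDensity_le (hν : IsCharge m ν) (hν₀ : ∀ E, MeasurableSet E → 0 ≤ ν E)
    (hf : ∀ k, MeasurableSet (f ⁻¹' {k})) (X : κ → ℝ) {E : Set α} (hE : MeasurableSet E) :
    |withStepDensity ν f X E| ≤ (∑ k, |X k|) * ν E := by
  rw [Finset.sum_mul]
  refine (Finset.abs_sum_le_sum_abs _ _).trans (Finset.sum_le_sum fun k _ => ?_)
  rw [abs_mul, abs_of_nonneg (hν₀ _ (hE.inter (hf k)))]
  gcongr
  exact hν.mono hν₀ (hE.inter (hf k)) hE inter_subset_left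

theorem withStepDensity_le_mul (hν : IsCharge m ν) (hν₀ : ∀ E, MeasurableSet E → 0 ≤ ν E)
    (hf : ∀ k, MeasurableSet (f ⁻¹' {k})) (X : κ → ℝ) {c : ℝ} {E : Set α} (hE : MeasurableSet E)
    (hXc : ∀ x ∈ E, X (f x) ≤ c) : withStepDensity ν f X E ≤ c * ν E := by
  rw [← hν.sum_inter_fiber hf hE, Finset.mul_sum]
  refine Finset.sum_le_sum fun k _ => ?_
  rcases (E ∩ f ⁻¹' {k}).eq_empty_or_nonempty with h | ⟨x, hxE, rfl⟩
  · simp only [h, hν.empty, mul_zero, le_refl]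
  · exact mul_le_mul_of_nonneg_right (hXc x hxE) (hν₀ _ (hE.inter (hf _)))

/-- The quadratic functional `∫ (X ∘ f)² dR - 2 ∫ (X ∘ f) dP`, which for measures is the squared
distance in `L²(R)` between `X ∘ f` and `dP/dR`, up to a constant independent of `f` and `X`. -/
def energy (P R : Set α → ℝ) (f : α → κ) (X : κ → ℝ) : ℝ :=
  ∑ k, (X k ^ 2 * R (f ⁻¹' {k}) - 2 * X k * P (f ⁻¹' {k}))

theorem neg_univ_le_energy (hR : IsCharge m R) (hP₀ : ∀ E, MeasurableSet E → 0 ≤ P E)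
    (hPR : ∀ E, MeasurableSet E → P E ≤ R E) (hf : ∀ k, MeasurableSet (f ⁻¹' {k})) (X : κ → ℝ) :
    -R univ ≤ energy P R f X := by
  rw [← hR.sum_inter_fiber hf MeasurableSet.univ, ← Finset.sum_neg_distrib]
  refine Finset.sum_le_sum fun k _ => ?_
  rw [univ_inter]
  nlinarith [hP₀ _ (hf k), hPR _ (hf k), mul_nonneg (sq_nonneg (X k - 1)) (hP₀ _ (hf k)),
    mul_nonneg (sq_nonneg (X k)) (sub_nonneg.2 (hPR _ (hf k)))]

theorem energy_add_const_mul_indicator (hP : IsCharge m P) (hR : IsCharge m R)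
    (hf : ∀ k, MeasurableSet (f ⁻¹' {k})) (X : κ → ℝ) {A : Set α} [DecidablePred (· ∈ A)]
    (hA : MeasurableSet A) (c : ℝ) :
    energy P R (fun x => (f x, decide (x ∈ A))) (fun k => X k.1 + if k.2 then c else 0) =
      energy P R f X - 2 * c * (P A - withStepDensity R f X A) + c ^ 2 * R A := by
  have htrue (k : κ) : (fun x => (f x, decide (x ∈ A))) ⁻¹' {(k, true)} = A ∩ f ⁻¹' {k} := by
    ext x; simp [and_comm]
  have hfalse (k : κ) : (fun x => (f x, decide (x ∈ A))) ⁻¹' {(k, false)} = f ⁻¹' {k} \ A := by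
    ext x; simp
  rw [← hP.sum_inter_fiber hf hA, ← hR.sum_inter_fiber hf hA, energy, energy, withStepDensity,
    Fintype.sum_prod_type, ← Finset.sum_sub_distrib, Finset.mul_sum, Finset.mul_sum,
    ← Finset.sum_sub_distrib, ← Finset.sum_add_distrib]
  refine Finset.sum_congr rfl fun k _ => ?_
  rw [Fintype.sum_bool, htrue, hfalse, ← hP.inter_add_sdiff (hf k) hA,
    ← hR.inter_add_sdiff (hf k) hA, inter_comm (f ⁻¹' {k})]
  simp only [if_true, Bool.false_eq_true, if_false]
  ring

end StepDensity

theorem exists_energy_le_add (hR : IsCharge m R)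
    (hP₀ : ∀ E, MeasurableSet E → 0 ≤ P E) (hPR : ∀ E, MeasurableSet E → P E ≤ R E)
    {𝒞 : Set (Set α)} (h𝒞 : IsSetAlgebra 𝒞) (h𝒞m : ∀ C ∈ 𝒞, MeasurableSet C) {γ : ℝ} (hγ : 0 < γ) :
    ∃ (κ : Type) (_ : Fintype κ) (f : α → κ) (X : κ → ℝ), (∀ k, f ⁻¹' {k} ∈ 𝒞) ∧
      ∀ (κ' : Type) [Fintype κ'] (f' : α → κ') (X' : κ' → ℝ), (∀ k, f' ⁻¹' {k} ∈ 𝒞) →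
        energy P R f X ≤ energy P R f' X' + γ := by
  set V : Set ℝ := {e | ∃ (κ : Type) (_ : Fintype κ) (f : α → κ) (X : κ → ℝ),
    (∀ k, f ⁻¹' {k} ∈ 𝒞) ∧ energy P R f X = e}
  have hne : V.Nonempty :=
    ⟨_, Unit, inferInstance, fun _ => (), fun _ => 0, fun k => by simpa using h𝒞.univ_mem, rfl⟩
  have hbdd : BddBelow V := by
    refine ⟨-R univ, ?_⟩
    rintro _ ⟨κ, _, f, X, hf, rfl⟩
    exact neg_univ_le_energy hR hP₀ hPR (fun k => h𝒞m _ (hf k)) X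
  obtain ⟨_, ⟨κ, _, f, X, hf, rfl⟩, hlt⟩ := exists_lt_of_csInf_lt hne (lt_add_of_pos_right _ hγ)
  refine ⟨κ, _, f, X, hf, fun κ' _ f' X' hf' => hlt.le.trans ?_⟩
  gcongr
  exact csInf_le hbdd ⟨κ', _, f', X', hf', rfl⟩

/-- A finitely additive Radon-Nikodym theorem. A density need not exist, but a nearly optimal step
function for `energy` takes its place: an error on some `A ∈ 𝒞` could be corrected by adding a
multiple of the indicator of `A`, which would lower the energy. -/
theorem exists_forall_abs_sub_withStepDensity_le (hP : IsCharge m P) (hR : IsCharge m R)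
    (hP₀ : ∀ E, MeasurableSet E → 0 ≤ P E) (hPR : ∀ E, MeasurableSet E → P E ≤ R E)
    {𝒞 : Set (Set α)} (h𝒞 : IsSetAlgebra 𝒞) (h𝒞m : ∀ C ∈ 𝒞, MeasurableSet C)
    (hdense : ChargeDense m R 𝒞) {η : ℝ} (hη : 0 < η) :
    ∃ (κ : Type) (_ : Fintype κ) (f : α → κ) (X : κ → ℝ), (∀ k, f ⁻¹' {k} ∈ 𝒞) ∧
      ∀ E, MeasurableSet E → |P E - withStepDensity R f X E| ≤ η := by
  classical
  have hR₀ : ∀ E, MeasurableSet E → 0 ≤ R E := fun E hE => (hP₀ E hE).trans (hPR E hE)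
  have hR₁ := hR₀ univ MeasurableSet.univ
  set c := η / (R univ + 1)
  have hc₀ : 0 < c := by positivity
  obtain ⟨κ, _, f, X, hf, hmin⟩ :=
    exists_energy_le_add hR hP₀ hPR h𝒞 h𝒞m (pow_pos hc₀ 2)
  have hfm : ∀ k, MeasurableSet (f ⁻¹' {k}) := fun k => h𝒞m _ (hf k)
  refine ⟨κ, _, f, X, hf, fun E hE => (hP.sub (hR.withStepDensity hfm X)).abs_le_of_chargeDense hR
    h𝒞m hdense (M := 1 + ∑ k, |X k|) (by positivity) (fun F hF => ?_) (fun A hA => ?_) hE⟩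
  · calc |P F - withStepDensity R f X F| ≤ |P F| + |withStepDensity R f X F| := abs_sub _ _
      _ ≤ R F + (∑ k, |X k|) * R F := by
        gcongr
        · exact (abs_of_nonneg (hP₀ F hF)).trans_le (hPR F hF)
        · exact abs_withStepDensity_le hR hR₀ hfm X hF
      _ = (1 + ∑ k, |X k|) * R F := by ring
  · have hAm := h𝒞m A hA
    have hfiber : ∀ k, (fun x => (f x, decide (x ∈ A))) ⁻¹' {k} ∈ 𝒞 := by
      rintro ⟨k, b⟩
      have : (fun x => (f x, decide (x ∈ A))) ⁻¹' {(k, b)} = f ⁻¹' {k} ∩ if b then A else Aᶜ := by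
        ext x; cases b <;> simp
      rw [this]
      split_ifs
      exacts [h𝒞.inter_mem (hf k) hA, h𝒞.inter_mem (hf k) (h𝒞.compl_mem hA)]
    have hvar (d : ℝ) : 2 * d * (P A - withStepDensity R f X A) ≤ d ^ 2 * R univ + c ^ 2 := by
      have h := hmin _ _ (fun k => X k.1 + if k.2 then d else 0) hfiber
      rw [energy_add_const_mul_indicator hP hR hfm X hAm] at h
      have := mul_le_mul_of_nonneg_left (hR.mono hR₀ hAm MeasurableSet.univ (subset_univ A))
        (sq_nonneg d)
      linarith
    have hcη : c * (R univ + 1) = η := div_mul_cancel₀ _ (by positivity)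
    have hpos := hvar c
    have hneg := hvar (-c)
    rw [abs_le]
    constructor <;> nlinarith

variable {Q : Set α → ℝ}

theorem ChargeDense.add {𝒞 : Set (Set α)} (hP : ChargeDense m P 𝒞)
    (h𝒞m : ∀ C ∈ 𝒞, MeasurableSet C)
    (hQP : ∀ τ > 0, ∃ δ > 0, ∀ E, MeasurableSet E → P E < δ → Q E < τ) :
    ChargeDense m (fun E => P E + Q E) 𝒞 := fun E hE τ hτ => by
  obtain ⟨δ, hδ, hQ⟩ := hQP (τ / 2) (by positivity)
  obtain ⟨C, hC, hPC⟩ := hP E hE (min δ (τ / 2)) (by positivity)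
  have hQC := hQ _ (hE.symmDiff (h𝒞m C hC)) (hPC.trans_le (min_le_left _ _))
  exact ⟨C, hC, by linarith [hPC.trans_le (min_le_right δ (τ / 2))]⟩

theorem abs_sub_ite_div_mul_le {x c p q : ℝ} (hc : 0 < c) (hq : 0 ≤ q) :
    |q - (if x < c then 0 else (1 - x) / x) * p| ≤
      (if x < c then q else 0) + |p - x * (p + q)| / c := by
  split_ifs with hx
  · rw [zero_mul, sub_zero, abs_of_nonneg hq]
    exact le_add_of_nonneg_right (by positivity)
  · have hx₀ : 0 < x := hc.trans_le (not_lt.1 hx)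
    have heq : q - (1 - x) / x * p = -(p - x * (p + q)) / x := by
      field_simp
      ring
    rw [heq, abs_div, abs_neg, abs_of_pos hx₀, zero_add]
    gcongr
    exact not_lt.1 hx

/-- The step function `X` approximates `dP/d(P + Q)`, so `(1 - X) / X` approximates `dQ/dP` where
`X` is bounded away from `0`; the remaining set has small `P`-value, hence small `Q`-value. -/
theorem abs_sub_withStepDensity_div_le [Fintype κ] (hP : IsCharge m P) (hQ : IsCharge m Q)
    (hQ₀ : ∀ E, MeasurableSet E → 0 ≤ Q E) {f : α → κ} (hf : ∀ k, MeasurableSet (f ⁻¹' {k}))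
    {X : κ → ℝ} {c η : ℝ} (hc : 0 < c)
    (hη : ∀ E, MeasurableSet E → |P E - withStepDensity (fun E => P E + Q E) f X E| ≤ η)
    {E : Set α} (hE : MeasurableSet E) :
    |Q E - withStepDensity P f (fun k => if X k < c then 0 else (1 - X k) / X k) E| ≤
      Q (f ⁻¹' {k | X k < c}) + 2 * η / c := by
  set Y : κ → ℝ := fun k => if X k < c then 0 else (1 - X k) / X k
  set B := f ⁻¹' {k | X k < c}
  have hB : MeasurableSet B := measurableSet_preimage_of_fiber hf _
  have hR := hP.add hQ
  have hν := hP.sub (hR.withStepDensity hf X)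
  have hcell (k : κ) : |Q (E ∩ f ⁻¹' {k}) - withStepDensity P f Y (E ∩ f ⁻¹' {k})| ≤
      Q (E ∩ B ∩ f ⁻¹' {k}) +
        |P (E ∩ f ⁻¹' {k}) - withStepDensity (fun E => P E + Q E) f X (E ∩ f ⁻¹' {k})| / c := by
    rw [withStepDensity_of_subset_fiber hP.empty _ inter_subset_right,
      withStepDensity_of_subset_fiber hR.empty _ inter_subset_right]
    refine (abs_sub_ite_div_mul_le hc (hQ₀ _ (hE.inter (hf k)))).trans ?_
    gcongr
    split_ifs with hk
    · have hsub : f ⁻¹' {k} ⊆ B := fun x (hx : f x = k) => show X (f x) < c from hx ▸ hk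
      rw [inter_assoc, inter_eq_right.2 hsub]
    · exact hQ₀ _ ((hE.inter hB).inter (hf k))
  calc |Q E - withStepDensity P f Y E|
      = |∑ k, (Q (E ∩ f ⁻¹' {k}) - withStepDensity P f Y (E ∩ f ⁻¹' {k}))| := by
        rw [(hQ.sub (hP.withStepDensity hf Y)).sum_inter_fiber hf hE]
    _ ≤ ∑ k, (Q (E ∩ B ∩ f ⁻¹' {k}) +
        |P (E ∩ f ⁻¹' {k}) - withStepDensity (fun E => P E + Q E) f X (E ∩ f ⁻¹' {k})| / c) :=
      (Finset.abs_sum_le_sum_abs _ _).trans (Finset.sum_le_sum fun k _ => hcell k)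
    _ ≤ Q B + 2 * η / c := by
      rw [Finset.sum_add_distrib, hQ.sum_inter_fiber hf (hE.inter hB), ← Finset.sum_div]
      gcongr
      · exact hQ.mono hQ₀ (hE.inter hB) hB inter_subset_right
      · exact hν.sum_abs_le hη _ (fun k _ => hE.inter (hf k)) (pairwiseDisjoint_inter_fiber E f _)

theorem exists_forall_abs_sub_withStepDensity_le_of_absCont (hP : IsCharge m P)
    (hQ : IsCharge m Q) (hP₀ : ∀ E, MeasurableSet E → 0 ≤ P E)
    (hQ₀ : ∀ E, MeasurableSet E → 0 ≤ Q E)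
    (hQP : ∀ τ > 0, ∃ δ > 0, ∀ E, MeasurableSet E → P E < δ → Q E < τ)
    {𝒞 : Set (Set α)} (h𝒞 : IsSetAlgebra 𝒞) (h𝒞m : ∀ C ∈ 𝒞, MeasurableSet C)
    (hdense : ChargeDense m P 𝒞) {τ : ℝ} (hτ : 0 < τ) :
    ∃ (κ : Type) (_ : Fintype κ) (f : α → κ) (Y : κ → ℝ), (∀ k, f ⁻¹' {k} ∈ 𝒞) ∧
      ∀ E, MeasurableSet E → |Q E - withStepDensity P f Y E| ≤ τ := by
  obtain ⟨δ, hδ, hQδ⟩ := hQP (τ / 2) (by positivity)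
  have hR := hP.add hQ
  have hR₀ : ∀ E, MeasurableSet E → 0 ≤ P E + Q E := fun E hE => add_nonneg (hP₀ E hE) (hQ₀ E hE)
  have hR₁ := hR₀ univ MeasurableSet.univ
  set c := δ / (2 * (P univ + Q univ + 1)) with hc
  have hc₀ : 0 < c := by positivity
  obtain ⟨κ, _, f, X, hf, hη⟩ := exists_forall_abs_sub_withStepDensity_le hP hR hP₀
    (fun E hE => le_add_of_nonneg_right (hQ₀ E hE)) h𝒞 h𝒞m (hdense.add h𝒞m hQP)
    (η := min (δ / 2) (c * τ / 4)) (by positivity)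
  have hfm : ∀ k, MeasurableSet (f ⁻¹' {k}) := fun k => h𝒞m _ (hf k)
  have hB : MeasurableSet (f ⁻¹' {k | X k < c}) := measurableSet_preimage_of_fiber hfm _
  have hPB : P (f ⁻¹' {k | X k < c}) < δ := by
    have hX := withStepDensity_le_mul hR hR₀ hfm X hB fun x hx => le_of_lt hx
    have hmono := mul_le_mul_of_nonneg_left
      (hR.mono hR₀ hB MeasurableSet.univ (subset_univ _)) hc₀.le
    have hcR : c * (P univ + Q univ + 1) = δ / 2 := by rw [hc]; field_simp
    linarith [(le_abs_self _).trans (hη _ hB), min_le_left (δ / 2) (c * τ / 4)]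
  refine ⟨κ, _, f, _, hf, fun E hE =>
    (abs_sub_withStepDensity_div_le hP hQ hQ₀ hfm hc₀ hη hE).trans ?_⟩
  have hηc : 2 * min (δ / 2) (c * τ / 4) / c ≤ τ / 2 := by
    rw [div_le_iff₀ hc₀]
    linarith [min_le_right (δ / 2) (c * τ / 4)]
  linarith [hQδ _ hB hPB]

end Charge

section Paths

theorem exists_forall_mem_cylinder_eq {κ : Type*} {f : Path → κ} (hf : IsLocallyConstant f) :
    ∃ n, ∀ ω, ∀ ω' ∈ cylinder ω n, f ω' = f ω := by
  let U : ℕ → Set Path := fun n => {ω | ∀ ω' ∈ cylinder ω n, f ω' = f ω}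
  have hbasis := PiNat.isTopologicalBasis_cylinders (fun _ : ℕ => Bool)
  have hU_open (n : ℕ) : IsOpen (U n) := hbasis.isOpen_iff.2 fun ω hω =>
    ⟨cylinder ω n, ⟨ω, n, rfl⟩, self_mem_cylinder ω n, fun ω' hω' ω'' hω'' => by
      rw [mem_cylinder_iff_eq.1 hω'] at hω''
      rw [hω _ hω'', hω _ hω']⟩
  have hU_mono : Monotone U := fun n k hnk ω hω ω' hω' => hω ω' (cylinder_anti ω hnk hω')
  have hU_cover : univ ⊆ ⋃ n, U n := fun ω _ => by
    obtain ⟨_, ⟨x, n, rfl⟩, hω, hsub⟩ :=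
      hbasis.isOpen_iff.1 (hf.isOpen_fiber (f ω)) ω rfl
    rw [← mem_cylinder_iff_eq.1 hω] at hsub
    exact mem_iUnion.2 ⟨n, fun ω' hω' => hsub hω'⟩
  obtain ⟨n, hn⟩ := isCompact_univ.elim_directed_cover U hU_open hU_cover hU_mono.directed_le
  exact ⟨n, fun ω => hn (mem_univ ω)⟩

variable {𝓢 : MeasurableSpace Path}

theorem borel_le (h𝓢 : ∀ (ω : Path) (t : ℕ), MeasurableSet[𝓢] (cylinder ω t)) :
    borel Path ≤ 𝓢 := by
  rw [(PiNat.isTopologicalBasis_cylinders (fun _ : ℕ => Bool)).borel_eq_generateFrom]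
  refine MeasurableSpace.generateFrom_le ?_
  rintro _ ⟨ω, t, rfl⟩
  exact h𝓢 ω t

theorem measurableSet_of_isClosed (h𝓢 : ∀ (ω : Path) (t : ℕ), MeasurableSet[𝓢] (cylinder ω t))
    {F : Set Path} (hF : IsClosed F) : MeasurableSet[𝓢] F :=
  (borel_le h𝓢 _ (MeasurableSpace.measurableSet_generateFrom hF.isOpen_compl)).of_compl

theorem isSetAlgebra_isClopen {X : Type*} [TopologicalSpace X] :
    IsSetAlgebra {C : Set X | IsClopen C} where
  empty_mem := isClopen_empty
  compl_mem _ hC := hC.compl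
  union_mem _ _ hC hD := hC.union hD

/-- The outcomes of the first `t` periods, whose fibers are the cylinders `ω^t`. -/
def initSegment (t : ℕ) (ω : Path) : Fin t → Bool := fun i => ω i

theorem preimage_initSegment_singleton (t : ℕ) (ω : Path) :
    initSegment t ⁻¹' {initSegment t ω} = cylinder ω t := by
  ext ω'
  simp [initSegment, funext_iff, Fin.forall_iff, PiNat.mem_cylinder_iff]

theorem initSegment_surjective (t : ℕ) : Function.Surjective (initSegment t) :=
  Fin.val_injective.surjective_comp_right

theorem measurableSet_preimage_initSegment
    (h𝓢 : ∀ (ω : Path) (t : ℕ), MeasurableSet[𝓢] (cylinder ω t)) {t : ℕ}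
    (A : Set (Fin t → Bool)) : MeasurableSet[𝓢] (initSegment t ⁻¹' A) :=
  measurableSet_preimage_of_fiber ((initSegment_surjective t).forall.2 fun ω =>
    (preimage_initSegment_singleton t ω).symm ▸ h𝓢 ω t) A

end Paths

section Merging

variable {𝓢 : MeasurableSpace Path} (P Q : FinAddProb 𝓢)

theorem FinAddProb.isCharge : IsCharge 𝓢 P := fun E F => P.prob_union E F

theorem FinAddProb.apply_nonneg (E : Set Path) : 0 ≤ P E := by
  by_cases h : MeasurableSet[𝓢] E
  · exact P.nonneg E h
  · exact (P.zero_of_not_event E h).ge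

theorem FinAddProb.apply_compl {E : Set Path} (hE : MeasurableSet[𝓢] E) : P Eᶜ = 1 - P E := by
  have h := P.isCharge.inter_add_sdiff MeasurableSet.univ hE
  rw [univ_inter, ← compl_eq_univ_sdiff, P.prob_univ] at h
  linarith

variable {P Q}

theorem AbsCont.exists_pos (h : AbsCont Q P) {τ : ℝ} (hτ : 0 < τ) :
    ∃ δ > 0, ∀ E, MeasurableSet[𝓢] E → P E < δ → Q E < τ := by
  by_contra! hcon
  choose E hE hPE hQE using fun n : ℕ => hcon (1 / ((n : ℝ) + 1)) (by positivity)
  have hP : Tendsto (fun n => P (E n)) atTop (𝓝 0) :=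
    squeeze_zero (fun n => P.apply_nonneg _) (fun n => (hPE n).le)
      tendsto_one_div_add_atTop_nhds_zero_nat
  obtain ⟨n, hn⟩ := ((h E hE hP).eventually_lt_const hτ).exists
  exact absurd hn (not_lt.2 (hQE n))

theorem condProb_mul_apply {E C : Set Path} (hE : MeasurableSet[𝓢] E) (hC : MeasurableSet[𝓢] C) :
    condProb P E C * P C = P (E ∩ C) := by
  refine div_mul_cancel_of_imp fun h => le_antisymm ?_ (P.apply_nonneg _)
  exact (P.isCharge.mono P.nonneg (hE.inter hC) hC inter_subset_right).trans_eq h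

theorem condProb_mem_Icc {E C : Set Path} (hE : MeasurableSet[𝓢] E) (hC : MeasurableSet[𝓢] C) :
    condProb P E C ∈ Icc 0 1 :=
  ⟨div_nonneg (P.apply_nonneg _) (P.apply_nonneg _), div_le_one_of_le₀
    (P.isCharge.mono P.nonneg (hE.inter hC) hC inter_subset_right) (P.apply_nonneg _)⟩

theorem abs_condProb_sub_mul_le {E C : Set Path} (hE : MeasurableSet[𝓢] E)
    (hC : MeasurableSet[𝓢] C) (y : ℝ) :
    |condProb P E C - condProb Q E C| * Q C ≤
      |Q (E ∩ C) - y * P (E ∩ C)| + |Q C - y * P C| := by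
  have hP := condProb_mem_Icc (P := P) hE hC
  rw [← condProb_mul_apply (P := P) hE hC, ← condProb_mul_apply (P := Q) hE hC]
  calc |condProb P E C - condProb Q E C| * Q C
      = |(condProb P E C - condProb Q E C) * Q C| := by
        rw [abs_mul, abs_of_nonneg (Q.apply_nonneg C)]
    _ = |condProb P E C * (Q C - y * P C) -
          (condProb Q E C * Q C - y * (condProb P E C * P C))| := by congr 1; ring
    _ ≤ condProb P E C * |Q C - y * P C| +
          |condProb Q E C * Q C - y * (condProb P E C * P C)| := by
      refine (abs_sub _ _).trans_eq ?_
      rw [abs_mul, abs_of_nonneg hP.1]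
    _ ≤ _ := by
      rw [add_comm]
      gcongr
      exact mul_le_of_le_one_left (abs_nonneg _) hP.2

theorem exists_lt_abs_condProb_sub {ω : Path} {t : ℕ} {ε : ℝ} (h : ε < forecastDist P Q ω t) :
    ∃ E, MeasurableSet[𝓢] E ∧ ε < |condProb P E (cylinder ω t) - condProb Q E (cylinder ω t)| := by
  have : Nonempty {E : Set Path // MeasurableSet[𝓢] E} := ⟨∅, @MeasurableSet.empty _ 𝓢⟩
  obtain ⟨⟨E, hE⟩, hlt⟩ := exists_lt_of_lt_ciSup h
  exact ⟨E, hE, hlt⟩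

open Classical in
theorem setOf_lt_forecastDist_eq (P Q : FinAddProb 𝓢) (t : ℕ) (ε : ℝ) :
    {ω | ε < forecastDist P Q ω t} =
      ⋃ s ∈ ({s | ∃ ω, initSegment t ω = s ∧ ε < forecastDist P Q ω t} : Finset (Fin t → Bool)),
        univ ∩ initSegment t ⁻¹' {s} := by
  ext ω
  suffices ε < forecastDist P Q ω t ↔
      ∃ ω', initSegment t ω' = initSegment t ω ∧ ε < forecastDist P Q ω' t by simpa using this
  refine ⟨fun h => ⟨ω, rfl, h⟩, ?_⟩
  rintro ⟨ω', hω', h⟩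
  rwa [forecastDist, ← preimage_initSegment_singleton, hω', preimage_initSegment_singleton] at h

theorem mul_apply_setOf_lt_forecastDist_le
    (h𝓢 : ∀ (ω : Path) (t : ℕ), MeasurableSet[𝓢] (cylinder ω t)) {κ : Type*} [Fintype κ]
    {f : Path → κ} (hf : ∀ k, MeasurableSet[𝓢] (f ⁻¹' {k})) {Y : κ → ℝ} {η : ℝ}
    (hη : ∀ E, MeasurableSet[𝓢] E → |Q E - withStepDensity P f Y E| ≤ η) {t : ℕ}
    (ht : ∀ ω, ∀ ω' ∈ cylinder ω t, f ω' = f ω) (ε : ℝ) :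
    ε * Q {ω | ε < forecastDist P Q ω t} ≤ 4 * η := by
  classical
  set A : Finset (Fin t → Bool) := {s | ∃ ω, initSegment t ω = s ∧ ε < forecastDist P Q ω t}
  have hwitness (s) (hs : s ∈ A) : ∃ E, MeasurableSet[𝓢] E ∧
      ε < |condProb P E (initSegment t ⁻¹' {s}) - condProb Q E (initSegment t ⁻¹' {s})| := by
    obtain ⟨ω, rfl, h⟩ := (Finset.mem_filter.1 hs).2
    rw [preimage_initSegment_singleton]
    exact exists_lt_abs_condProb_sub h
  choose! E hE hεE using hwitness
  have hπm (s) := measurableSet_preimage_initSegment h𝓢 (t := t) {s}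
  set ν : Set Path → ℝ := fun E => Q E - withStepDensity P f Y E
  have hν : IsCharge 𝓢 ν := Q.isCharge.sub (P.isCharge.withStepDensity hf Y)
  have hbound (s) (hs : s ∈ A) :
      ε * Q (univ ∩ initSegment t ⁻¹' {s}) ≤
        |ν (E s ∩ initSegment t ⁻¹' {s})| + |ν (univ ∩ initSegment t ⁻¹' {s})| := by
    obtain ⟨ω, rfl, -⟩ := (Finset.mem_filter.1 hs).2
    have hfib : initSegment t ⁻¹' {initSegment t ω} ⊆ f ⁻¹' {f ω} :=
      (preimage_initSegment_singleton t ω).trans_subset (ht ω)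
    simp only [ν, univ_inter, withStepDensity_of_subset_fiber P.isCharge.empty Y hfib,
      withStepDensity_of_subset_fiber P.isCharge.empty Y (inter_subset_right.trans hfib)]
    exact (mul_le_mul_of_nonneg_right (hεE _ hs).le (Q.apply_nonneg _)).trans
      (abs_condProb_sub_mul_le (hE _ hs) (hπm _) (Y (f ω)))
  calc ε * Q {ω | ε < forecastDist P Q ω t} = ∑ s ∈ A, ε * Q (univ ∩ initSegment t ⁻¹' {s}) := by
        rw [setOf_lt_forecastDist_eq, Q.isCharge.apply_biUnion A
          (fun s _ => MeasurableSet.univ.inter (hπm s)) (pairwiseDisjoint_inter_fiber _ _ _),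
          Finset.mul_sum]
    _ ≤ ∑ s ∈ A, |ν (E s ∩ initSegment t ⁻¹' {s})| +
        ∑ s ∈ A, |ν (univ ∩ initSegment t ⁻¹' {s})| := by
      rw [← Finset.sum_add_distrib]
      exact Finset.sum_le_sum hbound
    _ ≤ 4 * η := by
      have h₁ := hν.sum_abs_le hη A (fun s hs => (hE s hs).inter (hπm s)) fun s _ r _ hsr =>
        ((disjoint_singleton.2 hsr).preimage (initSegment t)).mono inter_subset_right
          inter_subset_right
      have h₂ := hν.sum_abs_le hη A (fun s _ => MeasurableSet.univ.inter (hπm s))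
        (pairwiseDisjoint_inter_fiber _ _ _)
      linarith

theorem blackwellDubins_of_chargeDense
    (h𝓢 : ∀ (ω : Path) (t : ℕ), MeasurableSet[𝓢] (cylinder ω t))
    (hP : ChargeDense 𝓢 P {C | IsClopen C}) : BlackwellDubins P := by
  intro Q hQ ε hε
  refine tendsto_order.2 ⟨fun a ha => .of_forall fun t => ha.trans_le (Q.apply_nonneg _),
    fun γ hγ => ?_⟩
  have hclopen : ∀ C ∈ {C : Set Path | IsClopen C}, MeasurableSet[𝓢] C :=
    fun C hC => measurableSet_of_isClosed h𝓢 hC.isClosed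
  obtain ⟨κ, _, f, Y, hf, hη⟩ := exists_forall_abs_sub_withStepDensity_le_of_absCont P.isCharge
    Q.isCharge P.nonneg Q.nonneg (fun _ => hQ.exists_pos) isSetAlgebra_isClopen hclopen hP
    (τ := ε * γ / 8) (by positivity)
  obtain ⟨n, hn⟩ := exists_forall_mem_cylinder_eq
    (IsLocallyConstant.iff_isOpen_fiber.2 fun k => (hf k).isOpen)
  filter_upwards [eventually_ge_atTop n] with t ht
  have hle := mul_apply_setOf_lt_forecastDist_le h𝓢 (fun k => hclopen _ (hf k)) hη
    (fun ω ω' hω' => hn ω ω' (cylinder_anti ω ht hω')) ε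
  nlinarith [mul_pos hε hγ]

end Merging

section Capacity

variable {α : Type*} {𝒞 : Set (Set α)} {p : Set α → ℝ}

/-- A monotone, normalized, submodular set function which is additive along the sets in `𝒞` and
for which every set is almost covered by a member of `𝒞` of nearly the same size. -/
structure IsApproxCapacity (𝒞 : Set (Set α)) (p : Set α → ℝ) : Prop where
  mono : ∀ X Y, X ⊆ Y → p X ≤ p Y
  empty : p ∅ = 0
  univ : p univ = 1
  submod : ∀ X Y, p (X ∪ Y) + p (X ∩ Y) ≤ p X + p Y
  compl_le : ∀ C ∈ 𝒞, p C + p Cᶜ ≤ 1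
  approx : ∀ X, ∀ δ > 0, ∃ C ∈ 𝒞, p (X \ C) ≤ δ ∧ p C ≤ p X + δ

/-- The contraction `X ↦ p (X ∩ E) + p (X ∪ E) - p E` of `p` along `E`. It lies below `p` when `p`
is submodular, and a `p` that is minimal under it is additive. -/
def contract (p : Set α → ℝ) (E X : Set α) : ℝ := p (X ∩ E) + p (X ∪ E) - p E

namespace IsApproxCapacity

theorem nonneg (hp : IsApproxCapacity 𝒞 p) (X : Set α) : 0 ≤ p X :=
  hp.empty ▸ hp.mono _ _ (empty_subset X)

theorem union_le (hp : IsApproxCapacity 𝒞 p) (X Y : Set α) : p (X ∪ Y) ≤ p X + p Y := by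
  linarith [hp.submod X Y, hp.nonneg (X ∩ Y)]

theorem inter_add_sdiff_le (hp : IsApproxCapacity 𝒞 p) {C : Set α} (hC : C ∈ 𝒞) (Y : Set α) :
    p (Y ∩ C) + p (Y \ C) ≤ p Y := by
  have h := hp.submod (Y ∪ C) Cᶜ
  have hunion : (Y ∪ C) ∪ Cᶜ = Set.univ := by rw [union_assoc, union_compl_self, union_univ]
  have hinter : (Y ∪ C) ∩ Cᶜ = Y \ C := by rw [← sdiff_eq, union_sdiff_right]
  rw [hunion, hinter, hp.univ] at h
  linarith [hp.submod Y C, hp.compl_le C hC]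

theorem contract_le (hp : IsApproxCapacity 𝒞 p) (E X : Set α) : contract p E X ≤ p X := by
  unfold contract
  linarith [hp.submod X E]

theorem exists_contract_sdiff_le (hp : IsApproxCapacity 𝒞 p) (h𝒞 : IsSetRing 𝒞) (E X : Set α)
    {δ : ℝ} (hδ : 0 < δ) :
    ∃ C ∈ 𝒞, contract p E (X \ C) ≤ δ ∧ contract p E C ≤ contract p E X + δ := by
  obtain ⟨C₁, hC₁, hdiff₁, hle₁⟩ := hp.approx (X ∩ E) (δ / 4) (by positivity)
  obtain ⟨C₂, hC₂, hdiff₂, hle₂⟩ := hp.approx (X ∪ E) (δ / 4) (by positivity)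
  obtain ⟨C₃, hC₃, hdiff₃, hle₃⟩ := hp.approx E (δ / 4) (by positivity)
  set U := (X ∪ E) \ C₂ ∪ E \ C₃
  have hU : p U ≤ δ / 2 := by linarith [hp.union_le ((X ∪ E) \ C₂) (E \ C₃)]
  refine ⟨C₁ ∪ C₂ \ C₃, h𝒞.union_mem hC₁ (h𝒞.sdiff_mem hC₂ hC₃), ?_, ?_⟩
  · have hinter : p ((X \ (C₁ ∪ C₂ \ C₃)) ∩ E) ≤ p ((X ∩ E) \ C₁) :=
      hp.mono _ _ (by intro x; simp; tauto)
    have hunion : p ((X \ (C₁ ∪ C₂ \ C₃)) ∪ E) ≤ p (U ∪ C₃) :=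
      hp.mono _ _ (by intro x; simp [U]; tauto)
    unfold contract
    linarith [hp.union_le U C₃]
  · have hE : p E ≤ p (U ∪ C₂ ∩ C₃) := hp.mono _ _ (by intro x; simp [U]; tauto)
    refine (hp.contract_le E _).trans ?_
    unfold contract
    linarith [hp.union_le C₁ (C₂ \ C₃), hp.inter_add_sdiff_le hC₃ C₂, hp.union_le U (C₂ ∩ C₃)]

theorem isApproxCapacity_contract (h𝒞 : IsSetRing 𝒞) (hp : IsApproxCapacity 𝒞 p) (E : Set α) :
    IsApproxCapacity 𝒞 (contract p E) where
  mono X Y h := by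
    have hinter := hp.mono (X ∩ E) (Y ∩ E) (by gcongr)
    have hunion := hp.mono (X ∪ E) (Y ∪ E) (by gcongr)
    unfold contract
    linarith
  empty := by simp [contract, hp.empty]
  univ := by simp [contract, hp.univ]
  submod X Y := by
    have hinter := hp.submod (X ∩ E) (Y ∩ E)
    have hunion := hp.submod (X ∪ E) (Y ∪ E)
    rw [← union_inter_distrib_right, ← inter_inter_distrib_right] at hinter
    rw [← inter_union_distrib_right, ← union_union_distrib_right] at hunion
    unfold contract
    linarith
  compl_le C hC := by
    linarith [hp.compl_le C hC, hp.contract_le E C, hp.contract_le E Cᶜ]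
  approx X _ hδ := hp.exists_contract_sdiff_le h𝒞 E X hδ

theorem isApproxCapacity_iInf {c : Set (Set α → ℝ)} (hc : ∀ q ∈ c, IsApproxCapacity 𝒞 q)
    (hchain : IsChain (· ≤ ·) c) [Nonempty c] :
    IsApproxCapacity 𝒞 (fun X => ⨅ q : c, q.1 X) := by
  have : IsCodirectedOrder c := ⟨fun q q' => (hchain.total q.2 q'.2).elim
    (fun h => ⟨q, le_rfl, h⟩) (fun h => ⟨q', h, le_rfl⟩)⟩
  have hbdd (X : Set α) : BddBelow (range fun q : c => q.1 X) :=
    ⟨0, forall_mem_range.2 fun q => (hc q.1 q.2).nonneg X⟩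
  have hlim (X : Set α) : Tendsto (fun q : c => q.1 X) atBot (𝓝 (⨅ q : c, q.1 X)) :=
    tendsto_atBot_ciInf (fun _ _ h => h X) (hbdd X)
  exact
  { mono := fun X Y h =>
      le_of_tendsto_of_tendsto' (hlim X) (hlim Y) fun q => (hc q.1 q.2).mono X Y h
    empty := tendsto_nhds_unique (hlim ∅)
      (tendsto_const_nhds.congr fun q => (hc q.1 q.2).empty.symm)
    univ := tendsto_nhds_unique (hlim Set.univ)
      (tendsto_const_nhds.congr fun q => (hc q.1 q.2).univ.symm)
    submod := fun X Y => le_of_tendsto_of_tendsto' ((hlim _).add (hlim _))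
      ((hlim X).add (hlim Y)) fun q => (hc q.1 q.2).submod X Y
    compl_le := fun C hC => le_of_tendsto' ((hlim C).add (hlim Cᶜ)) fun q =>
      (hc q.1 q.2).compl_le C hC
    approx := fun X δ hδ => by
      obtain ⟨q, hq⟩ := exists_lt_of_ciInf_lt (lt_add_of_pos_right (⨅ q : c, q.1 X) (half_pos hδ))
      obtain ⟨C, hC, hdiff, hle⟩ := (hc q.1 q.2).approx X (δ / 2) (half_pos hδ)
      exact ⟨C, hC, by linarith [ciInf_le (hbdd (X \ C)) q], by linarith [ciInf_le (hbdd C) q]⟩ }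

theorem exists_isCharge_le (h𝒞 : IsSetRing 𝒞) (hp : IsApproxCapacity 𝒞 p) :
    ∃ q, IsApproxCapacity 𝒞 q ∧ q ≤ p ∧ IsCharge ⊤ q := by
  obtain ⟨q, hqp, hq, hmin⟩ := zorn_le_nonempty₀ (α := (Set α → ℝ)ᵒᵈ)
    {q | IsApproxCapacity 𝒞 (OrderDual.ofDual q)} (fun c hc hchain q₀ hq₀ => by
      let c' : Set (Set α → ℝ) := OrderDual.toDual ⁻¹' c
      have : Nonempty c' := ⟨⟨q₀, hq₀⟩⟩
      exact ⟨_, isApproxCapacity_iInf (c := c') (fun q hq => hc hq) hchain.symm, fun q hq X =>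
        ciInf_le (f := fun q : c' => q.1 X)
          ⟨0, forall_mem_range.2 fun q => (hc q.2).nonneg X⟩ ⟨q, hq⟩⟩) (OrderDual.toDual p) hp
  refine ⟨OrderDual.ofDual q, hq, hqp, fun X Y _ _ hXY => ?_⟩
  have hle : OrderDual.ofDual q X ≤ contract (OrderDual.ofDual q) Y X :=
    hmin (y := OrderDual.toDual (contract (OrderDual.ofDual q) Y))
      (isApproxCapacity_contract h𝒞 hq Y) (contract_le hq Y) X
  have hunion := IsApproxCapacity.union_le hq X Y
  rw [contract, hXY.inter_eq, IsApproxCapacity.empty hq] at hle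
  linarith

end IsApproxCapacity

end Capacity

section ClusterSet

variable {α : Type*} [TopologicalSpace α] {l : Filter α} {S R : Set α}

/-- The set of cluster points of `l` within `S`. When `l` is the filter dual to an ideal, these are
the points near which `S` is not small. -/
def clusterSet (l : Filter α) (S : Set α) : Set α := {x | ClusterPt x (l ⊓ 𝓟 S)}

theorem clusterSet_mono (h : S ⊆ R) : clusterSet l S ⊆ clusterSet l R :=
  fun _ hx => hx.mono (inf_le_inf_left l (principal_mono.2 h))

theorem clusterSet_union : clusterSet l (S ∪ R) = clusterSet l S ∪ clusterSet l R := by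
  ext x
  simp only [clusterSet, mem_union, mem_ofPred_eq, ← sup_principal, inf_sup_left, clusterPt_sup]

theorem isClosed_clusterSet : IsClosed (clusterSet l S) := isClosed_setOfPred_clusterPt

theorem clusterSet_subset_closure : clusterSet l S ⊆ closure S :=
  fun _ hx => mem_closure_iff_clusterPt.2 hx.of_inf_right

theorem clusterSet_eq_empty (h : Sᶜ ∈ l) : clusterSet l S = ∅ :=
  eq_empty_of_forall_notMem fun x hx => hx.ne (by rw [inf_principal_eq_bot.2 h, inf_bot_eq])

variable [T2Space α] [CompactSpace α] [TotallyDisconnectedSpace α] [MeasurableSpace α]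
  (μ : Measure α) [IsProbabilityMeasure μ] [μ.OuterRegular]

theorem exists_isClopen_clusterSet_sdiff_eq_empty (l : Filter α) (S : Set α)
    {δ : ℝ} (hδ : 0 < δ) :
    ∃ C, IsClopen C ∧ clusterSet l (S \ C) = ∅ ∧ μ.real C ≤ μ.real (clusterSet l S) + δ := by
  obtain ⟨U, hSU, hU, hμU⟩ := (clusterSet l S).exists_isOpen_lt_add (measure_ne_top μ _)
    (ENNReal.ofReal_pos.2 hδ).ne'
  obtain ⟨C, hC, hSC, hCU⟩ := exists_clopen_of_closed_subset_open isClosed_clusterSet hU hSU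
  refine ⟨C, hC, ?_, ?_⟩
  · refine eq_empty_of_forall_notMem fun x hx => ?_
    have hxC := clusterSet_subset_closure (clusterSet_mono (sdiff_subset_compl S C) hx)
    rw [hC.compl.isClosed.closure_eq] at hxC
    exact hxC (hSC (clusterSet_mono sdiff_subset hx))
  · have h := ENNReal.toReal_mono (by finiteness) ((measure_mono hCU).trans hμU.le)
    rwa [ENNReal.toReal_add (measure_ne_top μ _) ENNReal.ofReal_ne_top,
      ENNReal.toReal_ofReal hδ.le] at h

variable [BorelSpace α]

theorem isApproxCapacity_clusterSet (hl : ∀ x, ClusterPt x l) :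
    IsApproxCapacity {C | IsClopen C} fun S => μ.real (clusterSet l S) where
  mono _ _ h := measureReal_mono (clusterSet_mono h)
  empty := by simp [clusterSet_eq_empty]
  univ := by simp [clusterSet, hl]
  submod S R := by
    rw [clusterSet_union,
      ← measureReal_union_add_inter (μ := μ) (isClosed_clusterSet (S := R)).measurableSet]
    exact add_le_add le_rfl (measureReal_mono
      (subset_inter (clusterSet_mono inter_subset_left) (clusterSet_mono inter_subset_right)))
  compl_le C hC := by
    rw [← probReal_add_probReal_compl (μ := μ) hC.1.measurableSet]
    exact add_le_add
      (measureReal_mono (clusterSet_subset_closure.trans hC.isClosed.closure_subset))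
      (measureReal_mono (clusterSet_subset_closure.trans hC.compl.isClosed.closure_subset))
  approx S δ hδ := by
    obtain ⟨C, hC, hSC, hle⟩ := exists_isClopen_clusterSet_sdiff_eq_empty μ l S hδ
    refine ⟨C, hC, by simp [hSC, hδ.le], (measureReal_mono ?_).trans hle⟩
    exact clusterSet_subset_closure.trans hC.isClosed.closure_subset

theorem exists_isCharge_forall_isClosed_le (hl : ∀ x, ClusterPt x l) :
    ∃ q, IsApproxCapacity {C | IsClopen C} q ∧ IsCharge ⊤ q ∧ (∀ S, Sᶜ ∈ l → q S = 0) ∧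
      ∀ F, IsClosed F → q F ≤ μ.real F := by
  obtain ⟨q, hq, hle, hadd⟩ :=
    (isApproxCapacity_clusterSet μ hl).exists_isCharge_le isSetAlgebra_isClopen.isSetRing
  refine ⟨q, hq, hadd, fun S hS => le_antisymm ((hle S).trans ?_) (hq.nonneg S), fun F hF =>
    (hle F).trans (measureReal_mono (clusterSet_subset_closure.trans hF.closure_subset))⟩
  simp [clusterSet_eq_empty hS]

end ClusterSet

section Atomless

theorem exists_isProbabilityMeasure_nullSingletonClass (α : Type*) [MeasurableSpace α]
    [StandardBorelSpace α] [Uncountable α] :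
    ∃ μ : Measure α, IsProbabilityMeasure μ ∧ NullSingletonClass μ := by
  let e : ℝ ≃ᵐ α := PolishSpace.measurableEquivOfNotCountable
    (not_countable_iff.2 inferInstance) (not_countable_iff.2 inferInstance)
  let ν : Measure ℝ := volume.restrict (Icc 0 1)
  have : IsProbabilityMeasure ν := ⟨by simp [ν]⟩
  refine ⟨ν.map e, Measure.isProbabilityMeasure_map e.measurable.aemeasurable, ⟨fun x => ?_⟩⟩
  rw [e.map_apply]
  exact (subsingleton_singleton.preimage e.injective).measure_zero ν

theorem continuous_cdf (ν : Measure ℝ) [IsProbabilityMeasure ν] [NullSingletonClass ν] :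
    Continuous (ProbabilityTheory.cdf ν) := by
  refine continuous_iff_continuousAt.2 fun x => ?_
  have hmono := ProbabilityTheory.monotone_cdf ν
  have hjump := (ProbabilityTheory.cdf ν).measure_singleton x
  rw [ProbabilityTheory.measure_cdf, measure_singleton, eq_comm, ENNReal.ofReal_eq_zero] at hjump
  rw [hmono.continuousAt_iff_leftLim_eq_rightLim, StieltjesFunction.rightLim_eq]
  exact le_antisymm (hmono.leftLim_le le_rfl) (sub_nonpos.1 hjump)

theorem exists_continuous_measureReal_preimage_Icc {α : Type*} [MeasurableSpace α] (μ : Measure α)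
    [IsProbabilityMeasure μ] [NullSingletonClass μ] {X : α → ℝ} (hX : Measurable X)
    (hXinj : Function.Injective X) :
    ∃ G : ℝ → ℝ, Continuous G ∧ ∀ c d, c ≤ d → μ.real (X ⁻¹' Icc c d) = G d - G c := by
  set ν := μ.map X
  have : IsProbabilityMeasure ν := Measure.isProbabilityMeasure_map hX.aemeasurable
  have : NullSingletonClass ν := ⟨fun x => by
    rw [Measure.map_apply hX (measurableSet_singleton x)]
    exact (subsingleton_singleton.preimage hXinj).measure_zero μ⟩
  refine ⟨ProbabilityTheory.cdf ν, continuous_cdf ν, fun c d hcd => ?_⟩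
  rw [← map_measureReal_apply hX measurableSet_Icc, ProbabilityTheory.cdf_eq_real,
    ProbabilityTheory.cdf_eq_real, ← measureReal_congr (Ioc_ae_eq_Icc (μ := ν)), ← Iic_sdiff_Iic,
    measureReal_sdiff (Iic_subset_Iic.2 hcd) measurableSet_Iic]

/-- The embedding of the space of paths into the real line as the Cantor set. -/
noncomputable def cantorCoord (ω : Path) : ℝ := cantorSetHomeomorphNatToBool.symm ω

theorem continuous_cantorCoord : Continuous cantorCoord :=
  continuous_subtype_val.comp cantorSetHomeomorphNatToBool.symm.continuous

theorem cantorCoord_injective : Function.Injective cantorCoord :=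
  Subtype.val_injective.comp cantorSetHomeomorphNatToBool.symm.injective

theorem cantorCoord_mem_Icc (ω : Path) : cantorCoord ω ∈ Icc (0 : ℝ) 1 :=
  cantorSet_subset_unitInterval (cantorSetHomeomorphNatToBool.symm ω).2

variable {𝓢 : MeasurableSpace Path}

theorem isSavagean_of_cantorCoord_preimage_Icc_le
    (h𝓢 : ∀ (ω : Path) (t : ℕ), MeasurableSet[𝓢] (cylinder ω t)) {P : FinAddProb 𝓢} {G : ℝ → ℝ}
    (hG : Continuous G) (hPG : ∀ c d, c ≤ d → P (cantorCoord ⁻¹' Icc c d) ≤ G d - G c) :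
    IsSavagean P := by
  intro E hE α hα₀ hα₁
  have hmeas {A : Set ℝ} (hA : IsClosed A) : MeasurableSet[𝓢] (cantorCoord ⁻¹' A) :=
    measurableSet_of_isClosed h𝓢 (hA.preimage continuous_cantorCoord)
  have hIoc (c d : ℝ) (hcd : c ≤ d) : P (cantorCoord ⁻¹' Ioc c d) ≤ G d - G c := by
    have hm : MeasurableSet[𝓢] (cantorCoord ⁻¹' Ioc c d) := by
      rw [← Iic_sdiff_Iic]
      exact (hmeas isClosed_Iic).diff (hmeas isClosed_Iic)
    exact (P.isCharge.mono P.nonneg hm (hmeas isClosed_Icc)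
      (preimage_mono Ioc_subset_Icc_self)).trans (hPG c d hcd)
  exact P.isCharge.exists_subset_apply_eq P.nonneg cantorCoord_mem_Icc
    (fun _ => hmeas isClosed_Iic) hG hIoc hE
    ⟨mul_nonneg hα₀ (P.apply_nonneg E), mul_le_of_le_one_left (P.apply_nonneg E) hα₁⟩

end Atomless

section Opinion

variable {I : Set (Set Path)}

/-- The filter of the sets whose complement is small. The empty set has to be added to the small
sets because a strictly proper ideal may have no member at all. -/
def IsStrictlyProperIdeal.dualFilter (hI : IsStrictlyProperIdeal I) : Filter Path :=
  comk (fun S => S = ∅ ∨ S ∈ I) (Or.inl rfl)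
    (fun R hR S hS => by
      rcases hR with rfl | hR
      · exact .inl (subset_empty_iff.1 hS)
      · exact .inr (hI.mem_of_subset _ _ hR hS))
    (fun R hR S hS => by
      rcases hR with rfl | hR
      · rwa [empty_union]
      · rcases hS with rfl | hS
        · exact .inr (by rwa [union_empty])
        · exact .inr (hI.union_mem _ _ hR hS))

theorem IsStrictlyProperIdeal.compl_mem_dualFilter (hI : IsStrictlyProperIdeal I) {S : Set Path}
    (hS : S ∈ I) : Sᶜ ∈ hI.dualFilter :=
  compl_mem_comk.2 (.inr hS)

theorem IsStrictlyProperIdeal.clusterPt_dualFilter (hI : IsStrictlyProperIdeal I) (ω : Path) :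
    ClusterPt ω hI.dualFilter := by
  refine clusterPt_iff_nonempty.2 fun U hU S hS => ?_
  obtain ⟨_, ⟨ω', t, rfl⟩, -, hsub⟩ :=
    (PiNat.isTopologicalBasis_cylinders (fun _ : ℕ => Bool)).mem_nhds_iff.1 hU
  by_contra hempty
  have hdisj : Disjoint U S := disjoint_iff_inter_eq_empty.2 (not_nonempty_iff_eq_empty.1 hempty)
  have hcyl : cylinder ω' t ⊆ Sᶜ := hsub.trans hdisj.subset_compl_right
  rcases mem_comk.1 hS with h | h
  · exact (hcyl (self_mem_cylinder ω' t)) ((compl_empty_iff.1 h) ▸ mem_univ ω')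
  · exact hI.cylinder_notMem ω' t (hI.mem_of_subset _ _ h hcyl)

theorem IsStrictlyProperIdeal.exists_isCharge_forall_eq_zero (hI : IsStrictlyProperIdeal I) :
    ∃ q, IsApproxCapacity {C | IsClopen C} q ∧ IsCharge ⊤ q ∧ (∀ S ∈ I, q S = 0) ∧
      ∃ G : ℝ → ℝ, Continuous G ∧ ∀ c d, c ≤ d → q (cantorCoord ⁻¹' Icc c d) ≤ G d - G c := by
  have : Uncountable Path :=
    Cardinal.aleph0_lt_mk_iff.1 (by simpa using Cardinal.cantor Cardinal.aleph0)
  obtain ⟨μ, _, _⟩ := exists_isProbabilityMeasure_nullSingletonClass Path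
  obtain ⟨q, hq, hadd, hzero, hqμ⟩ := exists_isCharge_forall_isClosed_le μ hI.clusterPt_dualFilter
  obtain ⟨G, hG, hμG⟩ := exists_continuous_measureReal_preimage_Icc μ
    continuous_cantorCoord.measurable cantorCoord_injective
  exact ⟨q, hq, hadd, fun S hS => hzero S (hI.compl_mem_dualFilter hS), G, hG, fun c d hcd =>
    (hqμ _ (isClosed_Icc.preimage continuous_cantorCoord)).trans_eq (hμG c d hcd)⟩

variable {𝓢 : MeasurableSpace Path} {q : Set Path → ℝ} {𝒞 : Set (Set Path)}

open Classical in
/-- The restriction to the events of a finitely additive probability that is defined on all sets of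
paths. -/
noncomputable def IsApproxCapacity.toFinAddProb (hq : IsApproxCapacity 𝒞 q) (hadd : IsCharge ⊤ q)
    (𝓢 : MeasurableSpace Path) : FinAddProb 𝓢 where
  toFun E := if MeasurableSet[𝓢] E then q E else 0
  zero_of_not_event E hE := if_neg hE
  nonneg E hE := by rw [if_pos hE]; exact hq.nonneg E
  prob_univ := by rw [if_pos MeasurableSet.univ]; exact hq.univ
  prob_union E F hE hF h := by
    rw [if_pos hE, if_pos hF, if_pos (hE.union hF)]
    exact hadd trivial trivial h

theorem IsApproxCapacity.toFinAddProb_apply (hq : IsApproxCapacity 𝒞 q) (hadd : IsCharge ⊤ q)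
    {E : Set Path} (hE : MeasurableSet[𝓢] E) : hq.toFinAddProb hadd 𝓢 E = q E :=
  if_pos hE

theorem IsApproxCapacity.chargeDense_toFinAddProb (hq : IsApproxCapacity 𝒞 q)
    (hadd : IsCharge ⊤ q) (h𝒞 : ∀ C ∈ 𝒞, MeasurableSet[𝓢] C) :
    ChargeDense 𝓢 (hq.toFinAddProb hadd 𝓢) 𝒞 := by
  intro E hE δ hδ
  obtain ⟨C, hC, hdiff, hle⟩ := hq.approx E (δ / 4) (by positivity)
  refine ⟨C, hC, ?_⟩
  rw [hq.toFinAddProb_apply hadd (hE.symmDiff (h𝒞 C hC)), Set.symmDiff_def,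
    hadd trivial trivial disjoint_sdiff_sdiff]
  have hE_split := hadd.inter_add_sdiff (m := ⊤) (E := E) (F := C) trivial trivial
  have hC_split := hadd.inter_add_sdiff (m := ⊤) (E := C) (F := E) trivial trivial
  rw [inter_comm] at hC_split
  linarith

theorem exists_mem_opinionsBD_forall_eq_zero
    (h𝓢 : ∀ (ω : Path) (t : ℕ), MeasurableSet[𝓢] (cylinder ω t)) (hI : IsStrictlyProperIdeal I) :
    ∃ P ∈ opinionsBD 𝓢, ∀ S ∈ I, P.1 S = 0 := by
  obtain ⟨q, hq, hadd, hzero, G, hG, hqG⟩ := hI.exists_isCharge_forall_eq_zero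
  have hsavagean : IsSavagean (hq.toFinAddProb hadd 𝓢) :=
    isSavagean_of_cantorCoord_preimage_Icc_le h𝓢 hG fun c d hcd =>
      (hq.toFinAddProb_apply hadd (measurableSet_of_isClosed h𝓢
        (isClosed_Icc.preimage continuous_cantorCoord))).trans_le (hqG c d hcd)
  have hdense : ChargeDense 𝓢 (hq.toFinAddProb hadd 𝓢) {C | IsClopen C} :=
    hq.chargeDense_toFinAddProb hadd fun C hC => measurableSet_of_isClosed h𝓢 hC.isClosed
  refine ⟨⟨_, hsavagean⟩, blackwellDubins_of_chargeDense h𝓢 hdense, fun S hS => ?_⟩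
  by_cases hSm : MeasurableSet[𝓢] S
  · exact (hq.toFinAddProb_apply hadd hSm).trans (hzero S hS)
  · exact FinAddProb.zero_of_not_event _ S hSm

/-- The strategy that always announces the opinion `P`. -/
noncomputable def Strategy.pure (P : Opinion 𝓢) : Strategy 𝓢 :=
  ⟨PMF.pure P, by rw [PMF.support_pure]; exact finite_singleton P⟩

theorem Strategy.prob_pure_eq_one_iff (P : Opinion 𝓢) (A : Set (Opinion 𝓢)) :
    (Strategy.pure P).prob A = 1 ↔ P ∈ A := by
  rw [Strategy.prob, Strategy.pure, PMF.toOuterMeasure_apply_eq_one_iff, PMF.support_pure,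
    singleton_subset_iff]

end Opinion

end OpinionTest

theorem corollary1_general (𝓢 : MeasurableSpace OpinionTest.Path)
    (h𝓢 : ∀ (ω : OpinionTest.Path) (t : ℕ), MeasurableSet[𝓢] (PiNat.cylinder ω t))
    (I : Set (Set OpinionTest.Path)) (hI : OpinionTest.IsStrictlyProperIdeal I)
    (T : OpinionTest.Opinion 𝓢 → Set OpinionTest.Path)
    (hTm : ∀ P ∈ OpinionTest.opinionsBD 𝓢, MeasurableSet[𝓢] (T P)) (ε : ℝ) (hε₁ : ε < 1)
    (hT : ∀ P ∈ OpinionTest.opinionsBD 𝓢, P.1 (T P) ≤ ε) :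
    ∃ ζ : OpinionTest.Strategy 𝓢,
      {ω : OpinionTest.Path | ζ.prob {P : OpinionTest.Opinion 𝓢 | ω ∉ T P} = 1} ∉ I := by
  obtain ⟨P, hP, hzero⟩ := OpinionTest.exists_mem_opinionsBD_forall_eq_zero h𝓢 hI
  refine ⟨OpinionTest.Strategy.pure P, fun hsmall => ?_⟩
  simp only [OpinionTest.Strategy.prob_pure_eq_one_iff, mem_ofPred_eq] at hsmall
  have haccept : P.1 (T P)ᶜ = 0 := hzero _ hsmall
  linarith [hT P hP, P.1.apply_compl (hTm P hP)]

theorem corollary1 (𝓢 : MeasurableSpace OpinionTest.Path)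
    (h𝓢 : ∀ (ω : OpinionTest.Path) (t : ℕ), MeasurableSet[𝓢] (PiNat.cylinder ω t))
    (I : Set (Set OpinionTest.Path)) (hI : OpinionTest.IsStrictlyProperIdeal I)
    (T : OpinionTest.Test 𝓢) (ε : ℝ) (hε₀ : 0 ≤ ε) (hε₁ : ε < 1)
    (hT : OpinionTest.ControlsTypeIError T (OpinionTest.opinionsBD 𝓢) ε) :
    ∃ ζ : OpinionTest.Strategy 𝓢,
      {ω : OpinionTest.Path | ζ.prob {P : OpinionTest.Opinion 𝓢 | ω ∉ T P} = 1} ∉ I := by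
  exact corollary1_general 𝓢 h𝓢 I hI (fun P => T P) (fun P _ =>
    (OpinionTest.measurableSet_of_isClosed h𝓢 (T P).isOpen.isClosed_compl).of_compl) ε hε₁ hT
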